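/- Let $d\ge 0$ be an integer, let $(\Omega,\mathcal F,\mathbb P)$ be a probability space, let $x_0$ and $M_1,M_2,\dots$ be $\mathbb R^d$-valued random variables on it, let $h:\mathbb R^d\to\mathbb R^d$, let $(a(n))_{n\ge0}$ be a sequence of positive reals, and let $$x_{n+1}=x_n+a(n)\,[h(x_n)+M_{n+1}],\qquad n\ge 0 .$$ Put $\mathcal F_n=\sigma(x_0,M_1,\dots,M_n)$. Let $V:\mathbb R^d\to[0,\infty)$ be differentiable with $\lim_{\|x\|\to\infty}V(x)=\infty$ and $\nabla V(x)\cdot h(x)\le 0$ for all $x$, and suppose that the set $H:=\{x:\nabla V(x)\cdot h(x)=0\}$ coincides with $\{x:V(x)=0\}$. Assume: - (A1) $h$ is Lipschitz: for some $0<c<\infty$, $\|h(x)-h(y)\|\le c\|x-y\|$ for all $x,y$. - (A2) $\sum_n a(n)=\infty$, $\sum_n a(n)^2<\infty$, and there is $c>0$ with $a(n)\le c\,a(m)$ for all $n\ge m$. - (A3) Each $M_{n+1}$, $n\ge 0$, is square integrable with $E[M_{n+1}\mid\mathcal F_n]=0$ a.s., and for some $0<c<\infty$, $E[\|M_{n+1}\|^2\mid\mathcal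 F_n]\le c(1+\|x_n\|^2)$ a.s. for all $n\ge0$. - (A4) $V$ is twice differentiable and its second order partial derivatives are bounded: for some $c<\infty$, $|\partial_i\partial_jV(x)|<c$ for all $i,j$ and all $x$. - (A5) For some $0<c<\infty$, $\|x\|^2<c(1+V(x))$ for all $x$. (The constants $c$ may differ.) Then $$\mathbb P[x_n\to H]=1,$$ where $x_n\to H$ means that the distance from $x_n$ to $H$ tends to $0$ as $n\to\infty$. -/

import Mathlib

open Filter Topology MeasureTheory

/-- The σ-algebra `σ(x₀, M₁, …, Mₙ)` on `Ω`. -/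
def historySigma {Ω E : Type*} [MeasurableSpace E] (x₀ : Ω → E) (M : ℕ → Ω → E) (n : ℕ) :
    MeasurableSpace Ω :=
  MeasurableSpace.comap x₀ inferInstance ⊔
    ⨆ i ∈ Finset.Icc 1 n, MeasurableSpace.comap (M i) inferInstance

/-- `σ(x₀, M₁, …, Mₙ)` is a sub-σ-algebra of the ambient one, so that conditional expectations
given it are the genuine ones. -/
theorem historySigma_le {Ω E : Type*} [mΩ : MeasurableSpace Ω] [MeasurableSpace E]
    {x₀ : Ω → E} {M : ℕ → Ω → E} (hx₀ : Measurable x₀) (hM : ∀ n, Measurable (M (n + 1))) (n : ℕ) :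
    historySigma x₀ M n ≤ mΩ := by
  refine sup_le hx₀.comap_le (iSup₂_le fun i hi => ?_)
  obtain ⟨j, rfl⟩ := Nat.exists_eq_add_of_le' (Finset.mem_Icc.mp hi).1
  exact (hM j).comap_le

/-- `σ(x₀, M₁, …, Mₙ)` increases with `n`. -/
theorem historySigma_mono {Ω E : Type*} [MeasurableSpace E] (x₀ : Ω → E) (M : ℕ → Ω → E) :
    Monotone (historySigma x₀ M) := fun _ _ hmn =>
  sup_le_sup le_rfl (biSup_mono fun _ hi => Finset.Icc_subset_Icc le_rfl hmn hi)

/-- The partial derivative `∂ᵢ f` of a function on `ℝᵈ`. -/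
noncomputable def partialDeriv {d : ℕ} (i : Fin d) (f : EuclideanSpace ℝ (Fin d) → ℝ) :
    EuclideanSpace ℝ (Fin d) → ℝ :=
  fun x => fderiv ℝ f x (EuclideanSpace.single i 1)

/-- `V̇(x) = ∇V(x) · h(x)`, the derivative of `V` along the vector field `h`. -/
noncomputable def orbitalDeriv {d : ℕ} (V : EuclideanSpace ℝ (Fin d) → ℝ)
    (h : EuclideanSpace ℝ (Fin d) → EuclideanSpace ℝ (Fin d)) (x : EuclideanSpace ℝ (Fin d)) : ℝ :=
  inner ℝ (gradient V x) (h x)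

/-- The set `H = {x : ∇V(x) · h(x) = 0}`. -/
def limitSet {d : ℕ} (V : EuclideanSpace ℝ (Fin d) → ℝ)
    (h : EuclideanSpace ℝ (Fin d) → EuclideanSpace ℝ (Fin d)) : Set (EuclideanSpace ℝ (Fin d)) :=
  {x | orbitalDeriv V h x = 0}

/-- The sequence `u` converges to the set `S`: the distance from `u n` to `S` tends to `0`
(the distance to the empty set is `∞`). -/
def ConvergesToSet {E : Type*} [PseudoEMetricSpace E] (u : ℕ → E) (S : Set E) : Prop :=
  Tendsto (fun n => Metric.infEDist (u n) S) atTop (𝓝 0)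

/-! The function `V` is almost a supermartingale along the iterates. Bounded second derivatives give
a Taylor bound for `V (x (n + 1))`. Conditionally on the history, the noise drops out of its
first-order term, leaving the decrement `a n * orbitalDeriv V h (x n) ≤ 0`. The second-order term is
at most a constant times `a n ^ 2 * (1 + ‖x n‖ ^ 2)`, and the growth condition absorbs this into `C
* a n ^ 2 * (1 + V (x n))`.

As the squared steps are summable, Robbins–Siegmund (`ae_tendsto_and_summable_of_condExp_succ_le`)
applies to `1 + V (x n)`: almost surely `V (x n)` converges and the weighted decrements are
summable. The rest is pathwise. A positive limit of `V` would keep the iterates in a compact set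
where the decrement rate is bounded below, contradicting the divergence of the sum of steps. So `V
(x n) → 0`, and coercivity turns this into convergence to the zero set, which is `H`. Boundedness of
the iterates is never assumed. -/

/-! ### Almost supermartingales -/

/-- **Robbins–Siegmund theorem**: a nonnegative almost supermartingale converges almost surely,
and the decrements it dominates are almost surely summable. -/
theorem ae_tendsto_and_summable_of_condExp_succ_le {Ω : Type*} {m0 : MeasurableSpace Ω}
    {μ : Measure Ω} [IsFiniteMeasure μ] {ℱ : Filtration ℕ m0} {W D : ℕ → Ω → ℝ} {b : ℕ → ℝ}
    (hb : ∀ n, 0 ≤ b n) (hb_sum : Summable b)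
    (hW : StronglyAdapted ℱ W) (hD : StronglyAdapted ℱ D)
    (hW_int : ∀ n, Integrable (W n) μ) (hD_int : ∀ n, Integrable (D n) μ)
    (hW_nonneg : ∀ n ω, 0 ≤ W n ω) (hD_nonneg : ∀ n ω, 0 ≤ D n ω)
    (hle : ∀ n, μ[W (n + 1) | ℱ n] ≤ᵐ[μ] fun ω => (1 + b n) * W n ω - D n ω) :
    ∀ᵐ ω ∂μ, (∃ c, Tendsto (fun n => W n ω) atTop (𝓝 c)) ∧ Summable (fun n => D n ω) := by
  -- Integrating factor: dividing by `P` removes the growth `1 + b n`, and summability of `b` keeps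
  -- `P` between `1` and a finite limit.
  set P : ℕ → ℝ := fun n => ∏ k ∈ Finset.range n, (1 + b k) with hP
  have hP_pos : ∀ n, 0 < P n := fun n =>
    Finset.prod_pos fun k _ => by linarith [hb k]
  have hP_succ : ∀ n, P (n + 1) = P n * (1 + b n) := fun n => Finset.prod_range_succ _ _
  obtain ⟨p, hp⟩ : ∃ p, Tendsto P atTop (𝓝 p) :=
    ⟨_, (Real.multipliable_one_add_of_summable hb_sum).hasProd.tendsto_prod_nat⟩
  have hP_mono : Monotone P := monotone_nat_of_le_succ fun n => by
    rw [hP_succ]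
    nlinarith [hb n, hP_pos n]
  have hP_le : ∀ n, P n ≤ p := fun n => hP_mono.ge_of_tendsto hp n
  have hp_pos : 0 < p := (hP_pos 0).trans_le (hP_le 0)
  set S : ℕ → Ω → ℝ := fun n => ∑ k ∈ Finset.range n, (P (k + 1))⁻¹ • D k with hS
  -- Adding back the discounted past decrements makes a genuine supermartingale, still nonnegative.
  set U : ℕ → Ω → ℝ := fun n => (P n)⁻¹ • W n + S n with hU
  have hS_apply : ∀ n ω, S n ω = ∑ k ∈ Finset.range n, (P (k + 1))⁻¹ * D k ω := fun n ω => by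
    simp [hS]
  have hS_nonneg : ∀ n ω, 0 ≤ S n ω := fun n ω => by
    rw [hS_apply]
    exact Finset.sum_nonneg fun k _ =>
      mul_nonneg (inv_nonneg.2 (hP_pos _).le) (hD_nonneg k ω)
  have hU_nonneg : ∀ n ω, 0 ≤ U n ω := fun n ω =>
    add_nonneg (mul_nonneg (inv_nonneg.2 (hP_pos n).le) (hW_nonneg n ω)) (hS_nonneg n ω)
  -- `S (n + 1)` only involves `D 0, …, D n`, so it is already known at time `n` and passes through
  -- the conditional expectation.
  have hS_meas : ∀ n m, n ≤ m + 1 → StronglyMeasurable[ℱ m] (S n) := fun n m hnm =>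
    Finset.stronglyMeasurable_sum _ fun k hk =>
      ((hD k).mono (ℱ.mono (by have := Finset.mem_range.1 hk; omega))).const_smul _
  have hS_int : ∀ n, Integrable (S n) μ := fun n =>
    integrable_finsetSum' _ fun k _ => (hD_int k).smul _
  have hU_super : Supermartingale U ℱ μ := by
    refine supermartingale_nat (fun n => ((hW n).const_smul _).add (hS_meas n n (by omega)))
      (fun n => ((hW_int n).smul _).add (hS_int n)) fun n => ?_
    have h1 : μ[U (n + 1) | ℱ n] =ᵐ[μ]
        μ[(P (n + 1))⁻¹ • W (n + 1) | ℱ n] + μ[S (n + 1) | ℱ n] :=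
      condExp_add ((hW_int _).smul _) (hS_int _) _
    have h2 : μ[(P (n + 1))⁻¹ • W (n + 1) | ℱ n] =ᵐ[μ] (P (n + 1))⁻¹ • μ[W (n + 1) | ℱ n] :=
      condExp_smul _ _ _
    rw [condExp_of_stronglyMeasurable (ℱ.le n) (hS_meas (n + 1) n le_rfl) (hS_int _)] at h1
    filter_upwards [h1, h2, hle n] with ω h1 h2 h3
    rw [h1, Pi.add_apply, h2, Pi.smul_apply, smul_eq_mul]
    have h4 := mul_le_mul_of_nonneg_left h3 (inv_nonneg.2 (hP_pos (n + 1)).le)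
    have h5 : S (n + 1) ω = S n ω + (P (n + 1))⁻¹ * D n ω := by
      rw [hS_apply, hS_apply, Finset.sum_range_succ]
    have h6 : (P (n + 1))⁻¹ * ((1 + b n) * W n ω - D n ω) + (P (n + 1))⁻¹ * D n ω
        = (P n)⁻¹ * W n ω := by
      have := (hP_pos n).ne'
      have hbn : 1 + b n ≠ 0 := by linarith [hb n]
      rw [hP_succ]
      field_simp
      ring
    have h7 : U n ω = (P n)⁻¹ * W n ω + S n ω := rfl
    rw [h7]
    linarith
  -- Nonnegativity makes the `L¹` norm of `U n` its integral, which is at most that of `U 0`; the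
  -- submartingale convergence theorem then applies to `-U`.
  have hbdd : ∀ n, eLpNorm ((-U) n) 1 μ ≤ (Real.toNNReal (∫ ω, U 0 ω ∂μ) : ENNReal) := fun n => by
    rw [Pi.neg_apply, eLpNorm_neg, eLpNorm_one_eq_lintegral_enorm,
      ← ofReal_integral_norm_eq_lintegral_enorm (hU_super.integrable n)]
    refine ENNReal.ofReal_le_ofReal ?_
    simp_rw [Real.norm_of_nonneg (hU_nonneg n _)]
    simpa using hU_super.setIntegral_le (Nat.zero_le n) MeasurableSet.univ
  filter_upwards [hU_super.neg.exists_ae_tendsto_of_bdd hbdd] with ω ⟨c, hc⟩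
  have hc' : Tendsto (fun n => U n ω) atTop (𝓝 (-c)) := by simpa using hc.neg
  obtain ⟨B, hB⟩ := hc'.bddAbove_range
  have hS_sum : Summable (fun k => (P (k + 1))⁻¹ * D k ω) := by
    refine summable_of_sum_range_le (c := B)
      (fun k => mul_nonneg (inv_nonneg.2 (hP_pos _).le) (hD_nonneg k ω)) fun n => ?_
    rw [← hS_apply]
    refine le_trans ?_ (hB ⟨n, rfl⟩)
    exact le_add_of_nonneg_left (mul_nonneg (inv_nonneg.2 (hP_pos n).le) (hW_nonneg n ω))
  constructor
  · have h1 := hS_sum.hasSum.tendsto_sum_nat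
    have h2 := (hc'.sub h1).mul hp
    refine ⟨_, h2.congr fun n => ?_⟩
    have h7 : U n ω = (P n)⁻¹ * W n ω + S n ω := rfl
    rw [h7, hS_apply]
    have := (hP_pos n).ne'
    field_simp
    ring
  · refine Summable.of_nonneg_of_le (fun k => hD_nonneg k ω) (fun k => ?_) (hS_sum.mul_left p)
    rw [← mul_assoc]
    refine le_mul_of_one_le_left (hD_nonneg k ω) ?_
    rw [← div_eq_mul_inv, one_le_div (hP_pos _)]
    exact hP_le _

/-! ### Taylor and growth estimates -/

/-- Taylor's inequality for a function with Lipschitz derivative. -/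
theorem le_add_fderiv_add_of_lipschitz_fderiv {E : Type*} [NormedAddCommGroup E] [NormedSpace ℝ E]
    {f : E → ℝ} {K : ℝ} (hK : 0 ≤ K) (hf : Differentiable ℝ f)
    (hlip : ∀ y z, ‖fderiv ℝ f y - fderiv ℝ f z‖ ≤ K * ‖y - z‖) (y u : E) :
    f (y + u) ≤ f y + fderiv ℝ f y u + K * ‖u‖ ^ 2 := by
  -- Mean value inequality on the ball of radius `‖u‖`, where the derivative stays within `K * ‖u‖`
  -- of its value at `y`. This costs a factor 2 against the sharp constant `K / 2`, which is
  -- harmless here.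
  have := (convex_closedBall y ‖u‖).norm_image_sub_le_of_norm_fderiv_le' (𝕜 := ℝ) (f := f)
    (φ := fderiv ℝ f y) (C := K * ‖u‖) (x := y) (y := y + u) (fun z _ => hf z)
    (fun z hz => (hlip z y).trans
      (mul_le_mul_of_nonneg_left (mem_closedBall_iff_norm.1 hz) hK))
    (by simp) (by simp)
  rw [add_sub_cancel_left] at this
  nlinarith [(abs_le.1 (Real.norm_eq_abs _ ▸ this)).2]

/-- Bounded second order partial derivatives make the derivative Lipschitz. -/
theorem exists_lipschitz_fderiv_of_partialDeriv_bounded {d : ℕ} {V : EuclideanSpace ℝ (Fin d) → ℝ}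
    (hdiff : Differentiable ℝ (fderiv ℝ V)) {c : ℝ}
    (hc : ∀ i j y, |partialDeriv i (partialDeriv j V) y| ≤ c) :
    ∃ K : ℝ, 0 ≤ K ∧ ∀ y z, ‖fderiv ℝ V y - fderiv ℝ V z‖ ≤ K * ‖y - z‖ := by
  have hpd : ∀ i j y, partialDeriv i (partialDeriv j V) y = fderiv ℝ (fderiv ℝ V) y
      (EuclideanSpace.single i 1) (EuclideanSpace.single j 1) := fun i j y => by
    have h := ((hdiff y).hasFDerivAt.clm_apply
      (hasFDerivAt_const (EuclideanSpace.single j (1 : ℝ)) y)).fderiv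
    unfold partialDeriv
    rw [h]
    simp
  -- For `d = 0` the bound is vacuous and `c` may be negative, hence `|c|`.
  have hc0 : 0 ≤ |c| := abs_nonneg c
  have hexp : ∀ u : EuclideanSpace ℝ (Fin d), u = ∑ i, u i • EuclideanSpace.single i (1 : ℝ) :=
    fun u => by
      simpa using ((EuclideanSpace.basisFun (Fin d) ℝ).sum_repr u).symm
  have hbound : ∀ y u v, ‖fderiv ℝ (fderiv ℝ V) y u v‖ ≤ (d * d * |c|) * ‖u‖ * ‖v‖ := by
    intro y u v
    have hterm : ∀ i j, ‖u i * (v j * partialDeriv i (partialDeriv j V) y)‖ ≤ |c| * ‖u‖ * ‖v‖ := by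
      intro i j
      have h3 := (hc i j y).trans (le_abs_self c)
      rw [norm_mul, norm_mul, Real.norm_eq_abs (partialDeriv _ _ _)]
      calc ‖u i‖ * (‖v j‖ * |partialDeriv i (partialDeriv j V) y|) ≤ ‖u‖ * (‖v‖ * |c|) := by
            gcongr
            · exact PiLp.norm_apply_le u i
            · exact PiLp.norm_apply_le v j
        _ = |c| * ‖u‖ * ‖v‖ := by ring
    have hsum : fderiv ℝ (fderiv ℝ V) y u v
        = ∑ j, ∑ i, u i * (v j * partialDeriv i (partialDeriv j V) y) := by
      conv_lhs => rw [hexp u, hexp v]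
      simp only [map_sum, map_smul, sum_apply, smul_apply, smul_eq_mul, hpd, Finset.mul_sum]
      exact Finset.sum_congr rfl fun j _ => Finset.sum_congr rfl fun i _ => by ring
    rw [hsum]
    calc _ ≤ ∑ _j : Fin d, ∑ _i : Fin d, |c| * ‖u‖ * ‖v‖ :=
          norm_sum_le_of_le _ fun j _ => norm_sum_le_of_le _ fun i _ => hterm i j
      _ = (d * d * |c|) * ‖u‖ * ‖v‖ := by simp; ring
  refine ⟨d * d * |c|, by positivity, fun y z => ?_⟩
  refine convex_univ.norm_image_sub_le_of_norm_fderiv_le (𝕜 := ℝ) (fun z _ => hdiff z)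
    (fun z _ => ?_) (Set.mem_univ z) (Set.mem_univ y)
  exact ContinuousLinearMap.opNorm_le_bound₂ _ (by positivity) (hbound z)

theorem le_mul_one_add_norm_of_lipschitz {E F : Type*} [SeminormedAddCommGroup E]
    [SeminormedAddCommGroup F] {g : E → F} {c : ℝ} (hc : 0 ≤ c)
    (hg : ∀ y z, ‖g y - g z‖ ≤ c * ‖y - z‖) (y : E) :
    ‖g y‖ ≤ (‖g 0‖ + c) * (1 + ‖y‖) := by
  have h1 := hg y 0
  have h2 : ‖g y‖ ≤ ‖g y - g 0‖ + ‖g 0‖ := by simpa using norm_add_le (g y - g 0) (g 0)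
  rw [sub_zero] at h1
  nlinarith [norm_nonneg y, norm_nonneg (g 0), mul_nonneg (norm_nonneg y) (norm_nonneg (g 0))]

theorem continuous_of_lipschitz_norm {E F : Type*} [SeminormedAddCommGroup E]
    [SeminormedAddCommGroup F] {g : E → F} {c : ℝ}
    (hg : ∀ y z, ‖g y - g z‖ ≤ c * ‖y - z‖) : Continuous g :=
  (LipschitzWith.of_dist_le' (K := c) fun y z => by
    rw [dist_eq_norm, dist_eq_norm]; exact hg y z).continuous

/-! ### The Lyapunov function along the recursion -/

section StochasticApproximation

variable {d : ℕ}

theorem orbitalDeriv_eq_fderiv {V : EuclideanSpace ℝ (Fin d) → ℝ}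
    (h : EuclideanSpace ℝ (Fin d) → EuclideanSpace ℝ (Fin d)) (y : EuclideanSpace ℝ (Fin d)) :
    orbitalDeriv V h y = fderiv ℝ V y (h y) :=
  inner_gradient_left

theorem continuous_orbitalDeriv {V : EuclideanSpace ℝ (Fin d) → ℝ}
    {h : EuclideanSpace ℝ (Fin d) → EuclideanSpace ℝ (Fin d)}
    (hV : Continuous (fderiv ℝ V)) (hh : Continuous h) : Continuous (orbitalDeriv V h) := by
  simp_rw [funext (orbitalDeriv_eq_fderiv h)]
  exact hV.clm_apply hh

/-- The iterates of the recursion are adapted to the history. -/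
theorem stronglyMeasurable_iterate {Ω : Type*} {x M : ℕ → Ω → EuclideanSpace ℝ (Fin d)}
    {h : EuclideanSpace ℝ (Fin d) → EuclideanSpace ℝ (Fin d)} {a : ℕ → ℝ} (hh : Continuous h)
    (hrec : ∀ n ω, x (n + 1) ω = x n ω + a n • (h (x n ω) + M (n + 1) ω)) (n : ℕ) :
    StronglyMeasurable[historySigma (x 0) M n] (x n) := by
  induction n with
  | zero =>
    exact (Measurable.mono (comap_measurable (x 0)) le_sup_left le_rfl).stronglyMeasurable
  | succ n ih =>
    have hx : StronglyMeasurable[historySigma (x 0) M (n + 1)] (x n) :=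
      ih.mono (historySigma_mono _ _ n.le_succ)
    have hM : StronglyMeasurable[historySigma (x 0) M (n + 1)] (M (n + 1)) := by
      refine (Measurable.mono (comap_measurable (M (n + 1))) ?_ le_rfl).stronglyMeasurable
      exact le_sup_of_le_right (le_iSup₂_of_le (n + 1) (by simp) le_rfl)
    rw [funext (hrec n)]
    have hsum := ((hh.comp_stronglyMeasurable hx).add hM).const_smul (a n)
    exact hx.add hsum

/-- The Lyapunov function converges along the iterates of a square integrable recursion, and the
weighted orbital derivatives are summable. -/
theorem ae_tendsto_lyapunov_of_memLp {Ω : Type*} [mΩ : MeasurableSpace Ω] {μ : Measure Ω}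
    [IsFiniteMeasure μ]
    {h : EuclideanSpace ℝ (Fin d) → EuclideanSpace ℝ (Fin d)} {a : ℕ → ℝ}
    {x M : ℕ → Ω → EuclideanSpace ℝ (Fin d)} {V : EuclideanSpace ℝ (Fin d) → ℝ}
    (hx₀ : Measurable (x 0)) (hM : ∀ n, Measurable (M (n + 1)))
    (hrec : ∀ n ω, x (n + 1) ω = x n ω + a n • (h (x n ω) + M (n + 1) ω))
    (hx₀_sq : MemLp (x 0) 2 μ)
    (hV_diff : Differentiable ℝ V) (hV_nonneg : ∀ y, 0 ≤ V y)
    (hV_dot : ∀ y, orbitalDeriv V h y ≤ 0)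
    {K : ℝ} (hK : 0 ≤ K) (hV_lip : ∀ y z, ‖fderiv ℝ V y - fderiv ℝ V z‖ ≤ K * ‖y - z‖)
    {c₁ : ℝ} (hc₁ : 0 ≤ c₁) (hh : ∀ y z, ‖h y - h z‖ ≤ c₁ * ‖y - z‖)
    (ha : ∀ n, 0 ≤ a n) (ha_sq : Summable fun n => a n ^ 2)
    (hM_sq : ∀ n, MemLp (M (n + 1)) 2 μ)
    (hM_mart : ∀ n, μ[M (n + 1) | historySigma (x 0) M n] =ᵐ[μ] 0)
    {c₂ : ℝ} (hc₂ : 0 ≤ c₂)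
    (hM_bound : ∀ n, μ[fun ω => ‖M (n + 1) ω‖ ^ 2 | historySigma (x 0) M n]
      ≤ᵐ[μ] fun ω => c₂ * (1 + ‖x n ω‖ ^ 2))
    {c₃ : ℝ} (hc₃ : 0 ≤ c₃) (hV_growth : ∀ y, ‖y‖ ^ 2 ≤ c₃ * (1 + V y)) :
    ∀ᵐ ω ∂μ, (∃ v, Tendsto (fun n => V (x n ω)) atTop (𝓝 v)) ∧
      Summable (fun n => a n * -orbitalDeriv V h (x n ω)) := by
  have hh_cont := continuous_of_lipschitz_norm hh
  have hDV_cont := continuous_of_lipschitz_norm hV_lip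
  set c₄ := ‖h 0‖ + c₁ with hc₄
  set c₅ := ‖fderiv ℝ V 0‖ + K with hc₅
  have hh_growth : ∀ y, ‖h y‖ ≤ c₄ * (1 + ‖y‖) := le_mul_one_add_norm_of_lipschitz hc₁ hh
  have hDV_growth : ∀ y, ‖fderiv ℝ V y‖ ≤ c₅ * (1 + ‖y‖) :=
    le_mul_one_add_norm_of_lipschitz hK hV_lip
  have hc₄0 : 0 ≤ c₄ := by positivity
  have hc₅0 : 0 ≤ c₅ := by positivity
  let ℱ : Filtration ℕ mΩ := ⟨historySigma (x 0) M, historySigma_mono _ _, historySigma_le hx₀ hM⟩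
  have hx_meas : ∀ n, StronglyMeasurable[ℱ n] (x n) := stronglyMeasurable_iterate hh_cont hrec
  have hx_aesm : ∀ n, AEStronglyMeasurable (x n) μ := fun n =>
    ((hx_meas n).mono (ℱ.le n)).aestronglyMeasurable
  have hone' : ∀ n, MemLp (x n) 2 μ → MemLp (fun ω => 1 + ‖x n ω‖) 2 μ := fun n hn => by
    have h1 : MemLp (fun _ : Ω => (1 : ℝ)) 2 μ := memLp_const 1
    exact h1.add hn.norm
  have hlin : ∀ n, MemLp (x n) 2 μ → MemLp (fun ω => h (x n ω)) 2 μ := fun n hn =>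
    (hone' n hn).of_le_mul (c := c₄) (hh_cont.comp_aestronglyMeasurable (hx_aesm n))
      (ae_of_all _ fun ω => by
        rw [Real.norm_of_nonneg (by positivity)]; exact hh_growth _)
  -- Square integrability propagates because `h` grows at most linearly; it makes every term of the
  -- Taylor bound integrable.
  have hx_sq : ∀ n, MemLp (x n) 2 μ := fun n => by
    induction n with
    | zero => exact hx₀_sq
    | succ n ih =>
      have h1 := ((hlin n ih).add (hM_sq n)).const_smul (a n)
      rw [funext (hrec n)]
      exact ih.add h1
  have hone : ∀ n, MemLp (fun ω => 1 + ‖x n ω‖) 2 μ := fun n => hone' n (hx_sq n)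
  have hone_int : ∀ n, Integrable (fun ω => (1 + ‖x n ω‖) ^ 2) μ := fun n => (hone n).integrable_sq
  have hx_int : ∀ n, Integrable (fun ω => ‖x n ω‖ ^ 2) μ := fun n => (hx_sq n).norm.integrable_sq
  have hMsq_int : ∀ n, Integrable (fun ω => ‖M (n + 1) ω‖ ^ 2) μ :=
    fun n => (hM_sq n).norm.integrable_sq
  have hDV_lp : ∀ n, MemLp (fun ω => fderiv ℝ V (x n ω)) 2 μ := fun n =>
    (hone n).of_le_mul (c := c₅) (hDV_cont.comp_aestronglyMeasurable (hx_aesm n))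
      (ae_of_all _ fun ω => by
        rw [Real.norm_of_nonneg (by positivity)]; exact hDV_growth _)
  have hpair : ∀ n (Y : Ω → EuclideanSpace ℝ (Fin d)), MemLp Y 2 μ →
      Integrable (fun ω => fderiv ℝ V (x n ω) (Y ω)) μ := fun n Y hY => by
    refine ((hDV_lp n).norm.integrable_mul hY.norm).mono'
      (isBoundedBilinearMap_apply.continuous.comp_aestronglyMeasurable
        ((hDV_lp n).1.prodMk hY.1)) (ae_of_all _ fun ω => ContinuousLinearMap.le_opNorm _ _)
  have hV_le : ∀ y, V y ≤ (V 0 + ‖fderiv ℝ V 0‖ + K) * (1 + ‖y‖) ^ 2 := fun y => by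
    have h1 := le_add_fderiv_add_of_lipschitz_fderiv hK hV_diff hV_lip 0 y
    have h2 := (le_abs_self _).trans ((fderiv ℝ V 0).le_opNorm y)
    rw [zero_add] at h1
    have h3 : 0 ≤ ‖y‖ := norm_nonneg y
    have h4 : V 0 * 1 ≤ V 0 * (1 + ‖y‖) ^ 2 :=
      mul_le_mul_of_nonneg_left (by nlinarith) (hV_nonneg 0)
    have h5 : ‖fderiv ℝ V 0‖ * ‖y‖ ≤ ‖fderiv ℝ V 0‖ * (1 + ‖y‖) ^ 2 :=
      mul_le_mul_of_nonneg_left (by nlinarith) (norm_nonneg _)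
    have h6 : K * ‖y‖ ^ 2 ≤ K * (1 + ‖y‖) ^ 2 := mul_le_mul_of_nonneg_left (by nlinarith) hK
    linarith
  have hV_int : ∀ n, Integrable (fun ω => V (x n ω)) μ := fun n =>
    ((hone_int n).const_mul _).mono' (hV_diff.continuous.comp_aestronglyMeasurable (hx_aesm n))
      (ae_of_all _ fun ω => by
        rw [Real.norm_of_nonneg (hV_nonneg _)]; exact hV_le _)
  have hD_int : ∀ n, Integrable (fun ω => a n * -orbitalDeriv V h (x n ω)) μ := fun n => by
    simp_rw [orbitalDeriv_eq_fderiv]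
    exact (hpair n _ (hlin n (hx_sq n))).neg.const_mul _
  have hW_meas : ∀ n, StronglyMeasurable[ℱ n] (fun ω => 1 + V (x n ω)) := fun n =>
    (continuous_const.add hV_diff.continuous).comp_stronglyMeasurable (hx_meas n)
  have hD_meas : ∀ n, StronglyMeasurable[ℱ n] (fun ω => a n * -orbitalDeriv V h (x n ω)) := fun n =>
    (continuous_const.mul (continuous_orbitalDeriv hDV_cont hh_cont).neg).comp_stronglyMeasurable
      (hx_meas n)
  -- the one-step inequality
  have hstep : ∀ n, ∀ ω, 1 + V (x (n + 1) ω) ≤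
      ((1 + V (x n ω)) - a n * -orbitalDeriv V h (x n ω)
        + a n ^ 2 * (4 * K * c₄ ^ 2) * (1 + ‖x n ω‖ ^ 2))
      + a n * fderiv ℝ V (x n ω) (M (n + 1) ω) + a n ^ 2 * (2 * K) * ‖M (n + 1) ω‖ ^ 2 := by
    intro n ω
    have h1 := le_add_fderiv_add_of_lipschitz_fderiv hK hV_diff hV_lip (x n ω)
      (a n • (h (x n ω) + M (n + 1) ω))
    rw [← hrec, map_smul, map_add, norm_smul, mul_pow, Real.norm_eq_abs, sq_abs, smul_eq_mul,
      ← orbitalDeriv_eq_fderiv] at h1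
    -- The 4 comes from two uses of `(p + q) ^ 2 ≤ 2 * (p ^ 2 + q ^ 2)`: to split drift from noise,
    -- and to expand `(1 + ‖x n ω‖) ^ 2`.
    have h2 : ‖h (x n ω) + M (n + 1) ω‖ ^ 2
        ≤ 4 * c₄ ^ 2 * (1 + ‖x n ω‖ ^ 2) + 2 * ‖M (n + 1) ω‖ ^ 2 := by
      have h3 := pow_le_pow_left₀ (norm_nonneg _) (norm_add_le (h (x n ω)) (M (n + 1) ω)) 2
      have h4 := pow_le_pow_left₀ (norm_nonneg _) (hh_growth (x n ω)) 2
      have h5 : c₄ ^ 2 * (1 + ‖x n ω‖) ^ 2 ≤ c₄ ^ 2 * (2 * (1 + ‖x n ω‖ ^ 2)) :=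
        mul_le_mul_of_nonneg_left (by nlinarith [sq_nonneg (1 - ‖x n ω‖)]) (sq_nonneg _)
      nlinarith [sq_nonneg (‖h (x n ω)‖ - ‖M (n + 1) ω‖)]
    have h6 := mul_le_mul_of_nonneg_left h2 (mul_nonneg hK (sq_nonneg (a n)))
    nlinarith
  -- Drift and noise contributions to the second-order term, times the factor `1 + c₃` that bounds
  -- `1 + ‖x n‖ ^ 2` by `1 + V (x n)`. Working with `1 + V` rather than `V` makes the error purely
  -- multiplicative.
  set C := (4 * K * c₄ ^ 2 + 2 * K * c₂) * (1 + c₃) with hC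
  have hC0 : 0 ≤ C := by positivity
  have key := ae_tendsto_and_summable_of_condExp_succ_le (μ := μ) (ℱ := ℱ)
    (W := fun n ω => 1 + V (x n ω)) (D := fun n ω => a n * -orbitalDeriv V h (x n ω))
    (b := fun n => C * a n ^ 2) (fun n => by positivity) (ha_sq.mul_left C) hW_meas hD_meas
    (fun n => (integrable_const 1).add (hV_int n)) hD_int
    (fun n ω => by have := hV_nonneg (x n ω); positivity)
    (fun n ω => mul_nonneg (ha n) (neg_nonneg.2 (hV_dot _))) ?_
  · filter_upwards [key] with ω ⟨⟨v, hv⟩, hs⟩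
    exact ⟨⟨v - 1, by simpa using hv.sub_const 1⟩, hs⟩
  intro n
  set R₁ : Ω → ℝ := fun ω => (1 + V (x n ω)) - a n * -orbitalDeriv V h (x n ω)
    + a n ^ 2 * (4 * K * c₄ ^ 2) * (1 + ‖x n ω‖ ^ 2) with hR₁
  set R₂ : Ω → ℝ := fun ω => fderiv ℝ V (x n ω) (M (n + 1) ω) with hR₂
  set R₃ : Ω → ℝ := fun ω => ‖M (n + 1) ω‖ ^ 2 with hR₃
  have hR₁_int : Integrable R₁ μ := (((integrable_const 1).add (hV_int n)).sub (hD_int n)).add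
    (((integrable_const 1).add (hx_int n)).const_mul _)
  have hR₁_meas : StronglyMeasurable[ℱ n] R₁ := ((hW_meas n).sub (hD_meas n)).add
    ((continuous_const.mul (continuous_const.add
      (continuous_norm.pow 2))).comp_stronglyMeasurable (hx_meas n))
  have hR₂_int : Integrable R₂ μ := hpair n _ (hM_sq n)
  have e1 : μ[fun ω => 1 + V (x (n + 1) ω) | ℱ n] ≤ᵐ[μ]
      μ[R₁ + a n • R₂ + (a n ^ 2 * (2 * K)) • R₃ | ℱ n] :=
    condExp_mono ((integrable_const 1).add (hV_int _))
      ((hR₁_int.add (hR₂_int.smul _)).add ((hMsq_int n).smul _)) (ae_of_all _ fun ω => hstep n ω)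
  have e2 := condExp_add (hR₁_int.add (hR₂_int.smul (a n)))
    ((hMsq_int n).smul (a n ^ 2 * (2 * K))) (ℱ n)
  have e3 := condExp_add hR₁_int (hR₂_int.smul (a n)) (ℱ n)
  have e4 := condExp_smul (μ := μ) (a n) R₂ (ℱ n)
  have e5 := condExp_smul (μ := μ) (a n ^ 2 * (2 * K)) R₃ (ℱ n)
  -- The derivative at `x n` is known at time `n` and pulls out, so the martingale property kills
  -- the linear noise term.
  have e6 : μ[R₂ | ℱ n] =ᵐ[μ] fun ω => fderiv ℝ V (x n ω) ((μ[M (n + 1) | ℱ n]) ω) :=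
    condExp_bilin_of_stronglyMeasurable_left
      (ContinuousLinearMap.id ℝ (EuclideanSpace ℝ (Fin d) →L[ℝ] ℝ))
      (hDV_cont.comp_stronglyMeasurable (hx_meas n)) hR₂_int ((hM_sq n).integrable (by norm_num))
  rw [condExp_of_stronglyMeasurable (ℱ.le n) hR₁_meas hR₁_int] at e3
  filter_upwards [e1, e2, e3, e4, e5, e6, hM_mart n, hM_bound n] with ω e1 e2 e3 e4 e5 e6 e7 e8
  have e9 : (μ[M (n + 1) | ℱ n]) ω = 0 := e7
  have e10 : (μ[R₃ | ℱ n]) ω ≤ c₂ * (1 + ‖x n ω‖ ^ 2) := e8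
  rw [e9, map_zero] at e6
  rw [e2, Pi.add_apply, e3, Pi.add_apply, e4, e5, Pi.smul_apply, Pi.smul_apply, e6, smul_zero,
    smul_eq_mul, add_zero] at e1
  refine e1.trans ?_
  have f1 := mul_le_mul_of_nonneg_left e10 (by positivity : 0 ≤ a n ^ 2 * (2 * K))
  have f2 : 1 + ‖x n ω‖ ^ 2 ≤ (1 + c₃) * (1 + V (x n ω)) := by
    nlinarith [hV_growth (x n ω), hV_nonneg (x n ω)]
  have f3 := mul_le_mul_of_nonneg_left f2
    (by positivity : 0 ≤ a n ^ 2 * (4 * K * c₄ ^ 2 + 2 * K * c₂))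
  simp only [hR₁, hC]
  nlinarith

end StochasticApproximation

/-! ### Deterministic convergence along a path -/

theorem isCompact_sublevel_of_tendsto_cobounded {E : Type*} [PseudoMetricSpace E] [ProperSpace E]
    {V : E → ℝ} (hV : Continuous V) (hV_lim : Tendsto V (Bornology.cobounded E) atTop) (r : ℝ) :
    IsCompact {y | V y ≤ r} := by
  refine Metric.isCompact_of_isClosed_isBounded (isClosed_le hV continuous_const) ?_
  rw [Bornology.isBounded_def]
  filter_upwards [hV_lim.eventually_gt_atTop r] with y hy using not_le.2 hy

/-- A sequence along which a nonnegative coercive continuous function `V` tends to `0` converges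
to the zero set of `V`. -/
theorem convergesToSet_zeros_of_tendsto_zero {E : Type*} [PseudoMetricSpace E] [ProperSpace E]
    {V : E → ℝ} (hV : Continuous V) (hV_nonneg : ∀ y, 0 ≤ V y)
    (hV_lim : Tendsto V (Bornology.cobounded E) atTop)
    {u : ℕ → E} (hu : Tendsto (fun n => V (u n)) atTop (𝓝 0)) :
    ConvergesToSet u {y | V y = 0} := by
  refine tendsto_order.2 ⟨fun _ h => absurd h not_lt_zero, fun ε hε => ?_⟩
  have hS : IsCompact ({y | V y ≤ 1} ∩ {y | ε ≤ Metric.infEDist y {y | V y = 0}}) :=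
    (isCompact_sublevel_of_tendsto_cobounded hV hV_lim 1).inter_right
      (isClosed_le continuous_const Metric.continuous_infEDist)
  -- On this compact set of points `ε`-far from the zeros, `V` has a positive minimum unless the set
  -- is empty. The argument also covers an empty zero set, where every distance is `∞`.
  rcases Set.eq_empty_or_nonempty
    ({y | V y ≤ 1} ∩ {y | ε ≤ Metric.infEDist y {y | V y = 0}}) with hemp | hne
  · filter_upwards [hu.eventually_le_const one_pos] with n hn
    by_contra hcon
    exact Set.eq_empty_iff_forall_notMem.1 hemp (u n) ⟨hn, not_lt.1 hcon⟩
  · obtain ⟨z, ⟨-, hz⟩, hmin⟩ := hS.exists_isMinOn hne hV.continuousOn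
    have hz_pos : 0 < V z := (hV_nonneg z).lt_of_ne fun h0 =>
      hε.not_ge (hz.trans (Metric.infEDist_zero_of_mem (s := {y | V y = 0}) h0.symm).le)
    filter_upwards [hu.eventually_le_const one_pos, hu.eventually_lt_const hz_pos] with n hn hn'
    by_contra hcon
    exact hn'.not_ge (hmin ⟨hn, not_lt.1 hcon⟩)

/-- If `V` converges along `u` and the weighted decrements `a n * g (u n)` are summable while the
weights are not, then the limit of `V` along `u` is `0`, provided `g` vanishes only at zeros of
`V`. -/
theorem tendsto_zero_of_summable_weighted {E : Type*} [PseudoMetricSpace E] [ProperSpace E]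
    {V g : E → ℝ} (hV : Continuous V) (hV_nonneg : ∀ y, 0 ≤ V y) (hg : Continuous g)
    (hg_nonneg : ∀ y, 0 ≤ g y) (hgV : ∀ y, g y = 0 → V y = 0)
    (hV_lim : Tendsto V (Bornology.cobounded E) atTop)
    {a : ℕ → ℝ} (ha : ∀ n, 0 ≤ a n) (ha_sum : ¬ Summable a) {u : ℕ → E} {v : ℝ}
    (hu : Tendsto (fun n => V (u n)) atTop (𝓝 v)) (hsum : Summable fun n => a n * g (u n)) :
    Tendsto (fun n => V (u n)) atTop (𝓝 0) := by
  rcases (ge_of_tendsto' hu fun n => hV_nonneg _).eq_or_lt with rfl | hv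
  · exact hu
  refine absurd ?_ ha_sum
  -- A compact shell that eventually contains `u n` and avoids the zeros of `V`; the minimum `g z`
  -- of `g` there is positive, so eventually `a n ≤ (g z)⁻¹ * (a n * g (u n))`, which would make `a`
  -- summable.
  have hS : IsCompact ({y | V y ≤ v + 1} ∩ {y | v / 2 ≤ V y}) :=
    (isCompact_sublevel_of_tendsto_cobounded hV hV_lim _).inter_right
      (isClosed_le continuous_const hV)
  have hev : ∀ᶠ n in atTop, u n ∈ {y | V y ≤ v + 1} ∩ {y | v / 2 ≤ V y} :=
    (hu.eventually_le_const (by linarith)).and (hu.eventually_const_le (by linarith))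
  obtain ⟨n₀, hn₀⟩ := hev.exists
  obtain ⟨z, ⟨-, hz⟩, hmin⟩ := hS.exists_isMinOn ⟨_, hn₀⟩ hg.continuousOn
  have hz_pos : 0 < g z := (hg_nonneg z).lt_of_ne fun h0 => by
    have h1 : v / 2 ≤ V z := hz
    rw [hgV z h0.symm] at h1
    linarith
  refine (hsum.mul_left (g z)⁻¹).of_norm_bounded_eventually_nat ?_
  filter_upwards [hev] with n hn
  have h1 : g z ≤ g (u n) := hmin hn
  rw [Real.norm_of_nonneg (ha n), inv_mul_eq_div, le_div_iff₀ hz_pos]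
  exact mul_le_mul_of_nonneg_left h1 (ha n)

/-! ### Almost sure convergence -/

theorem mainTheorem4 {d : ℕ} {Ω : Type*} [MeasurableSpace Ω] (μ : Measure Ω)
    [IsProbabilityMeasure μ]
    (h : EuclideanSpace ℝ (Fin d) → EuclideanSpace ℝ (Fin d)) (a : ℕ → ℝ)
    (x M : ℕ → Ω → EuclideanSpace ℝ (Fin d)) (V : EuclideanSpace ℝ (Fin d) → ℝ)
    -- the random variables and the recursion
    (hx₀ : Measurable (x 0)) (hM : ∀ n, Measurable (M (n + 1)))
    (hrec : ∀ n ω, x (n + 1) ω = x n ω + a n • (h (x n ω) + M (n + 1) ω))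
    -- the Lyapunov function
    (hV_diff : Differentiable ℝ V) (hV_nonneg : ∀ y, 0 ≤ V y)
    (hV_lim : Tendsto V (Bornology.cobounded (EuclideanSpace ℝ (Fin d))) atTop)
    (hV_dot : ∀ y, orbitalDeriv V h y ≤ 0)
    (hH : limitSet V h = {y | V y = 0})
    -- (A1)
    (A1 : ∃ c : ℝ, 0 < c ∧ ∀ y z, ‖h y - h z‖ ≤ c * ‖y - z‖)
    -- (A2)
    (A2_pos : ∀ n, 0 < a n)
    (A2_i : Tendsto (fun n => ∑ i ∈ Finset.range n, a i) atTop atTop)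
    (A2_ii : Summable fun n => a n ^ 2)
    (A2_iii : ∃ c : ℝ, 0 < c ∧ ∀ m n, m ≤ n → a n ≤ c * a m)
    -- (A3)
    (A3_sq : ∀ n, MemLp (M (n + 1)) 2 μ)
    (A3_mart : ∀ n, μ[M (n + 1) | historySigma (x 0) M n] =ᵐ[μ] 0)
    (A3_bound : ∃ c : ℝ, 0 < c ∧ ∀ n, μ[fun ω => ‖M (n + 1) ω‖ ^ 2 | historySigma (x 0) M n]
      ≤ᵐ[μ] fun ω => c * (1 + ‖x n ω‖ ^ 2))
    -- (A4)
    (A4_diff : Differentiable ℝ (fderiv ℝ V))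
    (A4_bound : ∃ c : ℝ, ∀ i j y, |partialDeriv i (partialDeriv j V) y| < c)
    -- (A5)
    (A5 : ∃ c : ℝ, 0 < c ∧ ∀ y, ‖y‖ ^ 2 < c * (1 + V y)) :
    μ {ω | ConvergesToSet (fun n => x n ω) (limitSet V h)} = 1 := by
  obtain ⟨c₁, hc₁, hh⟩ := A1
  obtain ⟨c₂, hc₂, hM_bound⟩ := A3_bound
  obtain ⟨c₃, hc₃, hV_growth⟩ := A5
  obtain ⟨c₄, hc₄⟩ := A4_bound
  obtain ⟨K, hK, hV_lip⟩ := exists_lipschitz_fderiv_of_partialDeriv_bounded A4_diff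
    fun i j y => (hc₄ i j y).le
  have hh_cont := continuous_of_lipschitz_norm hh
  have hDV_cont := A4_diff.continuous
  have ha_sum : ¬ Summable a := fun hs =>
    not_tendsto_nhds_of_tendsto_atTop A2_i _ hs.hasSum.tendsto_sum_nat
  have hle := historySigma_le (x₀ := x 0) hx₀ hM
  -- localise to the events on which the initial value is bounded
  have hloc : ∀ N : ℕ, ∀ᵐ ω ∂μ, ‖x 0 ω‖ ≤ N →
      (∃ v, Tendsto (fun n => V (x n ω)) atTop (𝓝 v)) ∧
        Summable (fun n => a n * -orbitalDeriv V h (x n ω)) := fun N => by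
    -- The initial value has no assumed moments, but it is bounded on `s`. Since `s` belongs to
    -- every history σ-algebra, restricting `μ` to `s` leaves the conditional expectations unchanged
    -- on `s`. The restriction is a finite measure, not normalised to a probability.
    set s : Set Ω := {ω | ‖x 0 ω‖ ≤ N} with hs
    have hs_hist : ∀ n, MeasurableSet[historySigma (x 0) M n] s := fun n => by
      have h0 : MeasurableSet[MeasurableSpace.comap (x 0) inferInstance] s :=
        ⟨{y | ‖y‖ ≤ N}, measurableSet_le measurable_norm measurable_const, rfl⟩
      exact (le_sup_left : _ ≤ historySigma (x 0) M n) _ h0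
    have hs_meas : MeasurableSet s := hle 0 _ (hs_hist 0)
    refine (ae_restrict_iff' hs_meas).1 ?_
    refine ae_tendsto_lyapunov_of_memLp hx₀ hM hrec ?_ hV_diff hV_nonneg hV_dot hK hV_lip hc₁.le hh
      (fun n => (A2_pos n).le) A2_ii (fun n => (A3_sq n).restrict s) (fun n => ?_) hc₂.le
      (fun n => ?_) hc₃.le (fun y => (hV_growth y).le)
    · exact MemLp.of_bound hx₀.aestronglyMeasurable N (ae_restrict_of_forall_mem hs_meas
        fun ω hω => hω)
    · exact (condExp_restrict_ae_eq_restrict (hle n) (hs_hist n)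
        ((A3_sq n).integrable (by norm_num))).trans (ae_restrict_of_ae (A3_mart n))
    · exact (condExp_restrict_ae_eq_restrict (hle n) (hs_hist n)
        (A3_sq n).norm.integrable_sq).le.trans (ae_restrict_of_ae (hM_bound n))
  have hae : ∀ᵐ ω ∂μ, ConvergesToSet (fun n => x n ω) (limitSet V h) := by
    filter_upwards [ae_all_iff.2 hloc] with ω hω
    -- The countably many localising events cover the whole space.
    obtain ⟨N, hN⟩ := exists_nat_ge ‖x 0 ω‖
    obtain ⟨⟨v, hv⟩, hsum⟩ := hω N hN
    rw [hH]
    refine convergesToSet_zeros_of_tendsto_zero hV_diff.continuous hV_nonneg hV_lim ?_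
    refine tendsto_zero_of_summable_weighted (g := fun y => -orbitalDeriv V h y)
      hV_diff.continuous hV_nonneg (continuous_orbitalDeriv hDV_cont hh_cont).neg
      (fun y => neg_nonneg.2 (hV_dot y)) (fun y hy => ?_) hV_lim (fun n => (A2_pos n).le) ha_sum
      hv hsum
    have hy' : y ∈ limitSet V h := neg_eq_zero.1 hy
    rwa [hH] at hy'
  rw [measure_congr (eventuallyEq_univ.2 hae), measure_univ]
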